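/- Let $X(t,\omega)$, $t\in\mathbb R$, be a (real-valued) symmetric stable process of index $\alpha\in[1,2]$ on a probability space: it has independent increments and there is a constant $C>0$ such that, for all $s\le t$, the increment $X(t)-X(s)$ has characteristic function $u\mapsto\exp(-C\,(t-s)\,|u|^{\alpha})$. Let $\gamma,\delta>-1$ and $\eta,\tau\ge 0$, put $\rho^{(a,b)}(t)=(1-t)^a(1+t)^b$, and let $p_n^{(\gamma,\delta)}$, $n\ge 0$, be the orthonormal Jacobi polynomials: $p_n^{(\gamma,\delta)}$ has degree $n$, positive leading coefficient, and $\int_{-1}^1 p_n^{(\gamma,\delta)}p_m^{(\gamma,\delta)}\rho^{(\gamma,\delta)}\,dt=\delta_{nm}$. Then the stochastic integrals $$A_n(\omega)=\int_{-1}^1 p_n^{(\gamma,\delta)}(t)\,\rho^{(\eta,\tau)}(t)\,dX(t,\omega),\qquad n\ge 0,$$ exist as limits in probability of Riemann–Stieltjes sums over tagged partitions of $[-1,1]$ as the mesh tends to $0$, and the following hold. 1. The random variables $A_0,A_1,A_2,\dots$ are not independent, except possibly in the Gaussian case $\alpha=2$ with the special weights $\gamma=2\eta$, $\delta=2\tau$.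 2. If $\alpha<2$, then moreover $A_n$ and $A_m$ are not independent for any $n\ne m$. -/

import Mathlib

open MeasureTheory ProbabilityTheory Filter Topology Polynomial

noncomputable section

/-- `X(t, ω)`, `t ∈ ℝ`, is a symmetric stable process of index `α` on `(Ω, P)`: its increments are
independent, and there is a constant `C > 0` such that, for all `s ≤ t`, the increment
`X t - X s` has the symmetric `α`-stable law with characteristic function
`u ↦ exp (-C (t - s) |u| ^ α)`. -/
structure IsSymmetricStable {Ω : Type*} [MeasurableSpace Ω] (P : Measure Ω) (α : ℝ)
    (X : ℝ → Ω → ℝ) : Prop where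
  measurable : ∀ t, Measurable (X t)
  indep : HasIndepIncrements X P
  charFun_increment : ∃ C : ℝ, 0 < C ∧ ∀ s t : ℝ, s ≤ t → ∀ u : ℝ,
    charFun (P.map (fun ω => X t ω - X s ω)) u =
      ((Real.exp (-C * (t - s) * |u| ^ α) : ℝ) : ℂ)

/-- A tagged partition `a = x₀ ≤ x₁ ≤ ⋯ ≤ x_N = b` of `[a, b]` with tags `ξᵢ ∈ [xᵢ, xᵢ₊₁]`. -/
structure IntervalPartition (a b : ℝ) where
  size : ℕ
  point : Fin (size + 1) → ℝ
  tag : Fin size → ℝ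
  point_zero : point 0 = a
  point_last : point (Fin.last size) = b
  mono : Monotone point
  tag_mem : ∀ i : Fin size, tag i ∈ Set.Icc (point i.castSucc) (point i.succ)

/-- The mesh of a tagged partition: the maximal length of its subintervals. -/
def IntervalPartition.mesh {a b : ℝ} (π : IntervalPartition a b) : ℝ :=
  ⨆ i : Fin π.size, (π.point i.succ - π.point i.castSucc)

/-- The Riemann–Stieltjes sum `∑ᵢ f(ξᵢ) (X(xᵢ₊₁, ω) - X(xᵢ, ω))`. -/
def IntervalPartition.stieltjesSum {Ω : Type*} {a b : ℝ} (π : IntervalPartition a b)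
    (X : ℝ → Ω → ℝ) (f : ℝ → ℝ) (ω : Ω) : ℝ :=
  ∑ i : Fin π.size, f (π.tag i) * (X (π.point i.succ) ω - X (π.point i.castSucc) ω)

/-- The random variable `I` is the stochastic integral `∫ₐᵇ f(t) dX(t, ω)` of a continuous function
`f`, in the sense of probability: the Riemann–Stieltjes sums converge to `I` in probability as
the mesh of the tagged partition tends to `0`. -/
structure IsStochasticIntegral {Ω : Type*} [MeasurableSpace Ω] (P : Measure Ω)
    (X : ℝ → Ω → ℝ) (a b : ℝ) (f : ℝ → ℝ) (I : Ω → ℝ) : Prop where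
  measurable : Measurable I
  tendsto : TendstoInMeasure P (fun π : IntervalPartition a b => π.stieltjesSum X f)
    (comap IntervalPartition.mesh (𝓝 0)) I

/-- The Jacobi weight `ρ^(γ,δ)(t) = (1 - t) ^ γ (1 + t) ^ δ`. -/
def jacobiWeight (γ δ t : ℝ) : ℝ := (1 - t) ^ γ * (1 + t) ^ δ

/-- The inner product `∫_{-1}^{1} p(t) q(t) ρ^(γ,δ)(t) dt` of two polynomials. -/
def jacobiInner (γ δ : ℝ) (p q : ℝ[X]) : ℝ :=
  ∫ t in (-1 : ℝ)..1, p.eval t * q.eval t * jacobiWeight γ δ t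

/-- The monic Jacobi polynomials: orthogonalization of `1, X, X², …` with respect to
`jacobiInner γ δ`. -/
def jacobiMonic (γ δ : ℝ) : ℕ → ℝ[X]
  | n => X ^ n - ∑ k : Fin n,
      C (jacobiInner γ δ (X ^ n) (jacobiMonic γ δ k) /
        jacobiInner γ δ (jacobiMonic γ δ k) (jacobiMonic γ δ k)) * jacobiMonic γ δ k
decreasing_by all_goals exact k.isLt

/-- The orthonormal Jacobi polynomial `p_n^(γ,δ)`: degree `n`, positive leading coefficient, and
`∫_{-1}^{1} p_n p_m ρ^(γ,δ) dt = 1` if `n = m` and `0` otherwise. -/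
def jacobiPoly (γ δ : ℝ) (n : ℕ) : ℝ[X] :=
  C (1 / √(jacobiInner γ δ (jacobiMonic γ δ n) (jacobiMonic γ δ n))) * jacobiMonic γ δ n

/-- `A` is the sequence of Fourier–Jacobi coefficients
`A_n(ω) = ∫_{-1}^{1} p_n^(γ,δ)(t) ρ^(η,τ)(t) dX(t, ω)` of the stochastic process `X`. -/
def IsFourierJacobiCoeff {Ω : Type*} [MeasurableSpace Ω] (P : Measure Ω) (X : ℝ → Ω → ℝ)
    (γ δ η τ : ℝ) (A : ℕ → Ω → ℝ) : Prop :=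
  ∀ n, IsStochasticIntegral P X (-1) 1
    (fun t => (jacobiPoly γ δ n).eval t * jacobiWeight η τ t) (A n)

end

/-! For continuous `f`, the integral of `f` against `X` is symmetric stable with scale parameter `C
∫ |f|^α`. Existence: over a common refinement, the difference of two Riemann–Stieltjes sums is
stable with scale controlled by the modulus of continuity of `f`. A tail bound from the
characteristic function then makes the sums Cauchy in probability.

Independence is tested on sums. If the integrals of `f` and `g` are independent, linearity and
comparison of characteristic functions give `∫ |f+g|^α = ∫ |f|^α + ∫ |g|^α`
(`integral_abs_add_rpow_of_indepFun`).

For `α < 2`, the same identity holds with `-g`. Adding the two contradicts the strict inequality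
`abs_add_rpow_add_abs_sub_rpow_lt` once `f` and `g` are both nonzero at some point, which always
happens for polynomials times a weight.

For `α = 2` the identity only says `∫ f g = 0`. Thus `p_1` and `p_2` are orthogonal to constants for
the squared weight with exponents `2η, 2τ`, so both weights have the same normalised first and
second moments. Pearson's equation shows that these moments determine the exponents
(`jacobi_exponents_eq`). -/

/-- A symmetric `α`-stable process with a specified scale constant `C`. -/
structure IsStableWithScale {Ω : Type*} [MeasurableSpace Ω] (P : Measure Ω) (α C : ℝ)
    (X : ℝ → Ω → ℝ) : Prop where
  measurable : ∀ t, Measurable (X t)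
  indep : HasIndepIncrements X P
  charFun_increment : ∀ s t : ℝ, s ≤ t → ∀ u : ℝ,
    charFun (P.map (fun ω => X t ω - X s ω)) u =
      ((Real.exp (-C * (t - s) * |u| ^ α) : ℝ) : ℂ)

theorem IsSymmetricStable.exists_scale {Ω : Type*} [MeasurableSpace Ω] {P : Measure Ω} {α : ℝ}
    {X : ℝ → Ω → ℝ} (h : IsSymmetricStable P α X) : ∃ C, 0 < C ∧ IsStableWithScale P α C X :=
  let ⟨C, hC, hc⟩ := h.charFun_increment
  ⟨C, hC, h.measurable, h.indep, hc⟩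

namespace IsStableWithScale

/-- Characteristic function of a finite linear combination of successive increments. -/
theorem charFun_map_sum_increments {Ω : Type*} [MeasurableSpace Ω] {P : Measure Ω}
    {X : ℝ → Ω → ℝ} {α C : ℝ} (hX : IsStableWithScale P α C X)
    (n : ℕ) (t : Fin (n + 1) → ℝ) (ht : Monotone t) (d : Fin n → ℝ) (u : ℝ) :
    charFun (P.map (fun ω => ∑ i, d i * (X (t i.succ) ω - X (t i.castSucc) ω))) u =
      ((Real.exp (-C * |u| ^ α * ∑ i, |d i| ^ α * (t i.succ - t i.castSucc)) : ℝ) : ℂ) := by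
  have hind : iIndepFun (fun (i : Fin n) ω => d i * (X (t i.succ) ω - X (t i.castSucc) ω)) P :=
    (hX.indep n t ht).comp (fun i x => d i * x) (fun i => by fun_prop)
  have hmeas : ∀ i : Fin n, Measurable fun ω => X (t i.succ) ω - X (t i.castSucc) ω :=
    fun i => (hX.measurable _).sub (hX.measurable _)
  rw [hind.charFun_map_fun_sum_eq_prod (fun i => ((hmeas i).const_mul _).aemeasurable),
    Finset.prod_apply, Finset.mul_sum, Real.exp_sum, Complex.ofReal_prod]
  refine Finset.prod_congr rfl fun i _ => ?_
  rw [charFun_map_mul_comp (hmeas i).aemeasurable, hX.charFun_increment _ _ (ht i.castSucc_lt_succ.le), abs_mul,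
    Real.mul_rpow (abs_nonneg _) (abs_nonneg _)]
  congr 2
  ring

end IsStableWithScale

/-! ### Tagged partitions: common refinements and Riemann sums. -/

namespace IntervalPartition

variable {a b : ℝ}

theorem le_mesh (π : IntervalPartition a b) (i : Fin π.size) :
    π.point i.succ - π.point i.castSucc ≤ π.mesh :=
  le_ciSup (f := fun i : Fin π.size => π.point i.succ - π.point i.castSucc)
    (Set.finite_range _).bddAbove i

theorem point_mem (π : IntervalPartition a b) (i : Fin (π.size + 1)) :
    π.point i ∈ Set.Icc a b :=
  ⟨π.point_zero.symm.trans_le (π.mono (Fin.zero_le i)),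
    (π.mono (Fin.le_last i)).trans_eq π.point_last⟩

theorem tag_mem_Icc (π : IntervalPartition a b) (i : Fin π.size) : π.tag i ∈ Set.Icc a b :=
  ⟨(π.point_mem _).1.trans (π.tag_mem i).1, (π.tag_mem i).2.trans (π.point_mem _).2⟩

/-- The cells `[p i, p (i + 1))` delimited by a monotone sequence of indices partition `[0, N)`. -/
theorem exists_cell {N n : ℕ} (p : Fin (n + 1) → ℕ) (hp : Monotone p) (h0 : p 0 = 0)
    (hN : p (Fin.last n) = N) :
    ∃ c : Fin N → Fin n, (∀ k : Fin N, p (c k).castSucc ≤ k ∧ (k : ℕ) < p (c k).succ) ∧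
      ∀ F : Fin n → ℕ → ℝ, ∑ i, ∑ k ∈ Finset.Ico (p i.castSucc) (p i.succ), F i k =
        ∑ k : Fin N, F (c k) k := by
  have hex : ∀ k : Fin N, ∃ i : Fin n, p i.castSucc ≤ k ∧ (k : ℕ) < p i.succ := by
    intro k
    by_contra! h
    -- If no cell contains `k`, every `p j` stays at or below `k`, including the last one, which is
    -- `N`.
    have : ∀ j : Fin (n + 1), p j ≤ k := by
      intro j
      induction j using Fin.induction with
      | zero => omega
      | succ i ih => exact h i ih
    have := this (Fin.last n)
    omega
  choose c hc using hex
  refine ⟨c, hc, fun F => ?_⟩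
  have huniq : ∀ (k : Fin N) (i : Fin n), p i.castSucc ≤ k → (k : ℕ) < p i.succ → c k = i := by
    intro k i h1 h2
    obtain ⟨h3, h4⟩ := hc k
    by_contra hne
    rcases lt_or_gt_of_ne hne with h | h
    · have := hp (show (c k).succ ≤ i.castSucc from by
        simp only [Fin.le_def, Fin.val_succ, Fin.val_castSucc, Fin.lt_def] at *; omega)
      omega
    · have := hp (show i.succ ≤ (c k).castSucc from by
        simp only [Fin.le_def, Fin.val_succ, Fin.val_castSucc, Fin.lt_def] at *; omega)
      omega
  rw [← Finset.sum_fiberwise (s := Finset.univ) (g := c)]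
  refine Finset.sum_congr rfl fun i _ => ?_
  symm
  refine Finset.sum_bij (fun k _ => (k : ℕ)) ?_ ?_ ?_ ?_
  · intro k hk
    simp only [Finset.mem_filter, Finset.mem_univ, true_and] at hk
    subst hk
    exact Finset.mem_Ico.2 (hc k)
  · intro k _ l _ h
    exact Fin.ext h
  · intro k hk
    rw [Finset.mem_Ico] at hk
    have hkN : k < N := hk.2.trans_le (hN ▸ hp (Fin.le_last _))
    exact ⟨⟨k, hkN⟩, by simpa using huniq ⟨k, hkN⟩ i hk.1 hk.2, rfl⟩
  · intro k hk
    simp only [Finset.mem_filter, Finset.mem_univ, true_and] at hk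
    rw [hk]

/-- A Riemann–Stieltjes sum can be rewritten over any finite set of points that contains the
points of the partition. -/
theorem exists_refine (π : IntervalPartition a b) (N : ℕ) (t : Fin (N + 1) → ℝ)
    (ht : StrictMono t) (h0 : t 0 = a) (hN : t (Fin.last N) = b)
    (hsub : ∀ i, π.point i ∈ Set.range t) :
    ∃ σ : Fin N → ℝ, (∀ k, σ k ∈ Set.Icc a b ∧ |σ k - t k.castSucc| ≤ π.mesh) ∧
      ∀ {Ω : Type*} (X : ℝ → Ω → ℝ) (f : ℝ → ℝ) (ω : Ω), π.stieltjesSum X f ω =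
        ∑ k, f (σ k) * (X (t k.succ) ω - X (t k.castSucc) ω) := by
  choose p hp using hsub
  have hpm : Monotone p := fun i j hij => by
    rw [← ht.le_iff_le, hp, hp]; exact π.mono hij
  have hp0 : p 0 = 0 := ht.injective (by rw [hp, h0, π.point_zero])
  have hpl : p (Fin.last _) = Fin.last N := ht.injective (by rw [hp, hN, π.point_last])
  obtain ⟨c, hc, hsum⟩ := exists_cell (N := N) (fun i => (p i : ℕ)) (fun i j h => hpm h)
    (by simp [hp0]) (by simp [hpl])
  refine ⟨fun k => π.tag (c k), fun k => ⟨π.tag_mem_Icc _, ?_⟩, fun X f ω => ?_⟩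
  · have h1 : π.point (c k).castSucc ≤ t k.castSucc := by
      rw [← hp]; exact ht.monotone (Fin.le_def.2 (hc k).1)
    have h2 : t k.castSucc ≤ π.point (c k).succ := by
      rw [← hp]; exact ht.monotone (Fin.le_def.2 (hc k).2.le)
    have h3 := π.tag_mem (c k)
    have h4 := π.le_mesh (c k)
    rw [abs_le]
    constructor <;> linarith [h3.1, h3.2]
  -- Clamping at `N` extends the values to all naturals, so the increments inside each cell
  -- telescope over an `Ico`.
  · set T : ℕ → ℝ := fun k => X (t ⟨min k N, by omega⟩) ω with hT
    have hTv : ∀ k : Fin (N + 1), T k = X (t k) ω := fun k => by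
      simp only [hT]
      congr 2
      exact Fin.ext (min_eq_left (Nat.lt_succ_iff.1 k.2))
    have := hsum (fun i k => f (π.tag i) * (T (k + 1) - T k))
    convert this using 1
    · unfold stieltjesSum
      refine Finset.sum_congr rfl fun i _ => ?_
      rw [← Finset.mul_sum, Finset.sum_Ico_sub _ (hpm i.castSucc_lt_succ.le), hTv, hTv, hp, hp]
    · refine Finset.sum_congr rfl fun k _ => ?_
      have e1 := hTv k.succ
      have e2 := hTv k.castSucc
      simp only [Fin.val_succ, Fin.val_castSucc] at e1 e2
      rw [e1, e2]

/-- Two partitions have a common refinement. -/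
theorem exists_common_points (π π' : IntervalPartition a b) :
    ∃ (N : ℕ) (t : Fin (N + 1) → ℝ), StrictMono t ∧ t 0 = a ∧ t (Fin.last N) = b ∧
      (∀ i, π.point i ∈ Set.range t) ∧ ∀ i, π'.point i ∈ Set.range t := by
  classical
  set T : Finset ℝ := Finset.univ.image π.point ∪ Finset.univ.image π'.point with hT
  have hTm : ∀ x ∈ T, x ∈ Set.Icc a b := by
    intro x hx
    simp only [hT, Finset.mem_union, Finset.mem_image, Finset.mem_univ, true_and] at hx
    rcases hx with ⟨i, rfl⟩ | ⟨i, rfl⟩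
    exacts [π.point_mem i, π'.point_mem i]
  have h1 : ∀ i, π.point i ∈ T := fun i => by simp [hT]
  have h2 : ∀ i, π'.point i ∈ T := fun i => by simp [hT]
  have hpos : 0 < T.card := Finset.card_pos.2 ⟨_, h1 0⟩
  obtain ⟨N, hN⟩ : ∃ N, T.card = N + 1 := ⟨T.card - 1, by omega⟩
  have hr : Set.range (T.orderEmbOfFin hN) = T := Finset.range_orderEmbOfFin T hN
  have hmem : ∀ k, T.orderEmbOfFin hN k ∈ Set.Icc a b :=
    fun k => hTm _ (Finset.orderEmbOfFin_mem T hN k)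
  refine ⟨N, T.orderEmbOfFin hN, (T.orderEmbOfFin hN).strictMono, ?_, ?_, fun i => ?_, fun i => ?_⟩
  · obtain ⟨k, hk⟩ : π.point 0 ∈ Set.range (T.orderEmbOfFin hN) := hr ▸ h1 0
    rw [π.point_zero] at hk
    exact le_antisymm (hk ▸ (T.orderEmbOfFin hN).monotone (Fin.zero_le k)) (hmem 0).1
  · obtain ⟨k, hk⟩ : π.point (Fin.last _) ∈ Set.range (T.orderEmbOfFin hN) := hr ▸ h1 _
    rw [π.point_last] at hk
    exact le_antisymm (hmem _).2 (hk ▸ (T.orderEmbOfFin hN).monotone (Fin.le_last k))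
  · exact hr ▸ h1 i
  · exact hr ▸ h2 i

/-- The partition of `[a, b]` into `n + 1` equal parts, tagged on the left. -/
noncomputable def uniform (hab : a ≤ b) (n : ℕ) : IntervalPartition a b where
  size := n + 1
  point i := a + (i : ℕ) * ((b - a) / (n + 1))
  tag i := a + (i : ℕ) * ((b - a) / (n + 1))
  point_zero := by simp
  point_last := by simp; field_simp; ring
  mono i j hij := by
    have : (0 : ℝ) ≤ (b - a) / (n + 1) := div_nonneg (by linarith) (by positivity)
    have : ((i : ℕ) : ℝ) ≤ (j : ℕ) := by exact_mod_cast hij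
    simp only
    gcongr
  tag_mem i := by
    have : (0 : ℝ) ≤ (b - a) / (n + 1) := div_nonneg (by linarith) (by positivity)
    constructor
    · simp
    · simp; linarith

theorem mesh_uniform (hab : a ≤ b) (n : ℕ) : (uniform hab n).mesh = (b - a) / (n + 1) := by
  have : ∀ i : Fin (uniform hab n).size, (uniform hab n).point i.succ -
      (uniform hab n).point i.castSucc = (b - a) / (n + 1) := by
    intro i
    change a + ((i.val + 1 : ℕ) : ℝ) * ((b - a) / (n + 1)) -
      (a + (i.val : ℝ) * ((b - a) / (n + 1))) = _
    push_cast
    ring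
  unfold mesh
  have : Nonempty (Fin (uniform hab n).size) := ⟨(0 : Fin (n + 1))⟩
  simp [*]

/-- Provides a sequence along which mesh limits can be evaluated, and shows that the mesh filter is
nontrivial. -/
theorem tendsto_uniform (hab : a ≤ b) :
    Tendsto (uniform hab) atTop (comap IntervalPartition.mesh (𝓝 0)) := by
  rw [tendsto_comap_iff]
  have : mesh ∘ uniform hab = fun n : ℕ => (b - a) / ((n : ℝ) + 1) :=
    funext fun n => mesh_uniform hab n
  rw [this]
  simpa [div_eq_mul_one_div (b - a)] using
    (tendsto_one_div_add_atTop_nhds_zero_nat (𝕜 := ℝ)).const_mul (b - a)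

theorem eventually_mesh_lt {δ : ℝ} (hδ : 0 < δ) :
    ∀ᶠ π : IntervalPartition a b in comap IntervalPartition.mesh (𝓝 0), π.mesh < δ :=
  tendsto_comap.eventually (gt_mem_nhds hδ)

theorem sum_length (n : ℕ) (t : Fin (n + 1) → ℝ) :
    ∑ i : Fin n, (t i.succ - t i.castSucc) = t (Fin.last n) - t 0 := by
  induction n with
  | zero => simp
  | succ n ih =>
    rw [Fin.sum_univ_castSucc]
    have := ih (fun i => t i.castSucc)
    simp only [Fin.succ_castSucc] at *
    simp only [this]
    simp

/-- Riemann sums of a continuous function converge to the integral. -/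
theorem tendsto_riemannSum {g : ℝ → ℝ} (hab : a ≤ b) (hg : ContinuousOn g (Set.Icc a b)) :
    Tendsto (fun π : IntervalPartition a b =>
      ∑ i, g (π.tag i) * (π.point i.succ - π.point i.castSucc))
      (comap IntervalPartition.mesh (𝓝 0)) (𝓝 (∫ x in a..b, g x)) := by
  rw [Metric.tendsto_nhds]
  intro ε hε
  -- The `+ 1` keeps the denominator positive when `a = b` and makes the final bound strict.
  have hε' : 0 < ε / (b - a + 1) := by have := sub_nonneg.2 hab; positivity
  obtain ⟨δ, hδ, h⟩ := Metric.uniformContinuousOn_iff.1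
    (isCompact_Icc.uniformContinuousOn_of_continuous hg) _ hε'
  filter_upwards [eventually_mesh_lt hδ] with π hπ
  have hint : ∀ i j, IntervalIntegrable g volume (π.point i) (π.point j) := fun i j =>
    (hg.mono (Set.uIcc_subset_Icc (π.point_mem i) (π.point_mem j))).intervalIntegrable
  have hsum : ∀ (n : ℕ) (t : Fin (n + 1) → ℝ),
      (∀ i j, IntervalIntegrable g volume (t i) (t j)) →
      ∫ x in t 0..t (Fin.last n), g x = ∑ i : Fin n, ∫ x in t i.castSucc..t i.succ, g x := by
    intro n
    induction n with
    | zero => simp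
    | succ n ih =>
      intro t ht
      rw [Fin.sum_univ_castSucc]
      have := ih (fun i => t i.castSucc) (fun i j => ht _ _)
      simp only [Fin.castSucc_zero, Fin.succ_castSucc] at *
      rw [← this, Fin.succ_last, intervalIntegral.integral_add_adjacent_intervals (ht _ _) (ht _ _)]
  have h1 := hsum _ π.point hint
  rw [π.point_zero, π.point_last] at h1
  rw [h1, Real.dist_eq, ← Finset.sum_sub_distrib]
  have hb : ∀ i : Fin π.size, |g (π.tag i) * (π.point i.succ - π.point i.castSucc) -
      ∫ x in π.point i.castSucc..π.point i.succ, g x| ≤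
      ε / (b - a + 1) * (π.point i.succ - π.point i.castSucc) := by
    intro i
    have hle := π.mono i.castSucc_lt_succ.le
    have : g (π.tag i) * (π.point i.succ - π.point i.castSucc) -
      ∫ x in π.point i.castSucc..π.point i.succ, g x =
      ∫ x in π.point i.castSucc..π.point i.succ, (g (π.tag i) - g x) := by
      rw [intervalIntegral.integral_sub (by simp) (hint _ _)]
      simp [mul_comm]
    rw [this, ← Real.norm_eq_abs]
    refine (intervalIntegral.norm_integral_le_of_norm_le_const (C := ε / (b - a + 1)) ?_).trans ?_
    · intro x hx
      rw [Set.uIoc_of_le hle] at hx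
      rw [Real.norm_eq_abs, ← Real.dist_eq]
      refine (h _ (π.tag_mem_Icc i) _ ⟨(π.point_mem _).1.trans hx.1.le,
        hx.2.trans (π.point_mem _).2⟩ ?_).le
      have := π.tag_mem i
      have := π.le_mesh i
      rw [Real.dist_eq, abs_lt]
      constructor <;> linarith [hx.1, hx.2, (π.tag_mem i).1, (π.tag_mem i).2]
    · rw [abs_of_nonneg (sub_nonneg.2 hle)]
  calc _ ≤ ∑ i : Fin π.size, ε / (b - a + 1) * (π.point i.succ - π.point i.castSucc) :=
        (Finset.abs_sum_le_sum_abs _ _).trans (Finset.sum_le_sum fun i _ => hb i)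
    _ = ε / (b - a + 1) * (b - a) := by
        rw [← Finset.mul_sum, sum_length, π.point_zero, π.point_last]
    _ < ε / (b - a + 1) * (b - a + 1) := by gcongr; linarith
    _ = ε := by have := sub_nonneg.2 hab; field_simp

end IntervalPartition

/-! ### Convergence in probability along a filter. -/

/-- Completeness for convergence in probability, along an arbitrary filter. -/
theorem exists_tendstoInMeasure_of_cauchy {Ω ι : Type*} [MeasurableSpace Ω] {P : Measure Ω}
    [IsProbabilityMeasure P] {l : Filter ι} [l.NeBot] {F : ι → Ω → ℝ}
    (hF : ∀ i, Measurable (F i))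
    (hc : ∀ ε : ℝ, 0 < ε → ∃ A ∈ l, ∀ i ∈ A, ∀ j ∈ A, P.real {ω | ε ≤ |F i ω - F j ω|} ≤ ε) :
    ∃ I : Ω → ℝ, Measurable I ∧ TendstoInMeasure P F l I := by
  have hpos : ∀ n : ℕ, (0 : ℝ) < (1 / 2) ^ n := fun n => by positivity
  choose A hA hAF using fun n : ℕ => hc _ (hpos n)
  -- Choosing `s n` in `A 0 ∩ ⋯ ∩ A n` puts both `s n` and `s (n + 1)` in `A n`, so consecutive
  -- terms are comparable.
  have hB : ∀ n : ℕ, ∃ i, ∀ k ≤ n, i ∈ A k := by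
    intro n
    have : (⋂ k ∈ Finset.range (n + 1), A k) ∈ l :=
      (biInter_finset_mem _).2 fun k _ => hA k
    obtain ⟨i, hi⟩ := Filter.nonempty_of_mem this
    simp only [Finset.mem_range, Set.mem_iInter] at hi
    exact ⟨i, fun k hk => hi k (by omega)⟩
  choose s hs using hB
  have hsum : ∑' n, P {ω | (1 / 2 : ℝ) ^ n ≤ |F (s n) ω - F (s (n + 1)) ω|} ≠ ⊤ := by
    have h1 : ∀ n, P {ω | (1 / 2 : ℝ) ^ n ≤ |F (s n) ω - F (s (n + 1)) ω|} ≤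
        ENNReal.ofReal ((1 / 2) ^ n) := fun n =>
      (ENNReal.le_ofReal_iff_toReal_le (measure_ne_top _ _) (hpos n).le).2
        (hAF n _ (hs n n le_rfl) _ (hs (n + 1) n n.le_succ))
    refine ne_top_of_le_ne_top ?_ (ENNReal.tsum_le_tsum h1)
    rw [← ENNReal.ofReal_tsum_of_nonneg (fun n => (hpos n).le)
      (summable_geometric_of_lt_one (by norm_num) (by norm_num))]
    exact ENNReal.ofReal_ne_top
  have hae : ∀ᵐ ω ∂P, ∃ x, Tendsto (fun n => F (s n) ω) atTop (𝓝 x) := by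
    -- Borel–Cantelli: almost surely, consecutive terms eventually differ by less than `(1/2)^n`.
    have h0 := measure_setOfPred_frequently_eq_zero hsum
    rw [← compl_mem_ae_iff] at h0
    filter_upwards [h0] with ω hω
    simp only [Set.mem_compl_iff, Set.mem_ofPred_eq, not_frequently, not_le] at hω
    obtain ⟨N, hN⟩ := eventually_atTop.1 hω
    have hcau : CauchySeq fun n => F (s (n + N)) ω := by
      refine cauchySeq_of_le_geometric (1 / 2) ((1 / 2) ^ N) (by norm_num) fun n => ?_
      have := hN (n + N) (by omega)
      rw [pow_add, mul_comm] at this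
      rw [Real.dist_eq, show n + 1 + N = n + N + 1 by ring]
      exact this.le
    obtain ⟨x, hx⟩ := cauchySeq_tendsto_of_complete hcau
    exact ⟨x, (tendsto_add_atTop_iff_nat (f := fun n => F (s n) ω) N).1 hx⟩
  obtain ⟨I, hI, hlim⟩ := measurable_limit_of_tendsto_metrizable_ae
    (fun n => (hF (s n)).aemeasurable) hae
  refine ⟨I, hI, ?_⟩
  have hseq := tendstoInMeasure_of_tendsto_ae (fun n => (hF (s n)).aestronglyMeasurable) hlim
  rw [tendstoInMeasure_iff_measureReal_dist] at hseq ⊢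
  intro ε hε
  rw [Metric.tendsto_nhds]
  intro η hη
  have hgeo : Tendsto (fun n : ℕ => (1 / 2 : ℝ) ^ n) atTop (𝓝 0) :=
    tendsto_pow_atTop_nhds_zero_of_lt_one (by norm_num) (by norm_num)
  obtain ⟨n, hn1, hn2, hn3⟩ := ((hgeo.eventually (gt_mem_nhds (half_pos hε))).and
    ((hgeo.eventually (gt_mem_nhds (half_pos hη))).and
    ((hseq _ (half_pos hε)).eventually (gt_mem_nhds (half_pos hη))))).exists
  filter_upwards [hA n] with i hi
  rw [Real.dist_eq, sub_zero, abs_of_nonneg measureReal_nonneg]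
  have hsub : {ω | ε ≤ dist (F i ω) (I ω)} ⊆
      {ω | (1 / 2 : ℝ) ^ n ≤ |F i ω - F (s n) ω|} ∪ {ω | ε / 2 ≤ dist (F (s n) ω) (I ω)} := by
    intro ω hω
    by_contra hcon
    simp only [Set.mem_union, Set.mem_ofPred_eq, not_or, not_le, Real.dist_eq] at hcon hω
    have := abs_sub_le (F i ω) (F (s n) ω) (I ω)
    linarith [hcon.1, hcon.2]
  calc _ ≤ _ := measureReal_mono hsub
    _ ≤ _ := measureReal_union_le _ _
    _ < η := by linarith [hAF n i hi (s n) (hs n n le_rfl)]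

theorem TendstoInMeasure.add {Ω ι : Type*} [MeasurableSpace Ω] {P : Measure Ω}
    [IsProbabilityMeasure P] {l : Filter ι} {F G : ι → Ω → ℝ} {I J : Ω → ℝ}
    (hF : TendstoInMeasure P F l I) (hG : TendstoInMeasure P G l J) :
    TendstoInMeasure P (fun i ω => F i ω + G i ω) l (fun ω => I ω + J ω) := by
  rw [tendstoInMeasure_iff_measureReal_dist] at *
  intro ε hε
  have := (hF _ (half_pos hε)).add (hG _ (half_pos hε))
  rw [add_zero] at this
  refine squeeze_zero (fun _ => measureReal_nonneg) (fun i => ?_) this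
  refine (measureReal_mono ?_).trans (measureReal_union_le _ _)
  intro ω hω
  by_contra hcon
  simp only [Set.mem_union, Set.mem_ofPred_eq, not_or, not_le] at hcon hω
  have := dist_add_add_le (F i ω) (G i ω) (I ω) (J ω)
  linarith [hcon.1, hcon.2]

theorem TendstoInMeasure.neg {Ω ι : Type*} [MeasurableSpace Ω] {P : Measure Ω}
    [IsProbabilityMeasure P] {l : Filter ι} {F : ι → Ω → ℝ} {I : Ω → ℝ}
    (hF : TendstoInMeasure P F l I) :
    TendstoInMeasure P (fun i ω => -F i ω) l (fun ω => -I ω) := by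
  rw [tendstoInMeasure_iff_measureReal_dist] at *
  simpa only [dist_neg_neg] using hF

theorem IntervalPartition.measurable_stieltjesSum {Ω : Type*} [MeasurableSpace Ω] {a b : ℝ}
    (π : IntervalPartition a b) {X : ℝ → Ω → ℝ} (hX : ∀ t, Measurable (X t)) (f : ℝ → ℝ) :
    Measurable (π.stieltjesSum X f) :=
  Finset.measurable_sum _ fun _ _ => ((hX _).sub (hX _)).const_mul _

/-! ### Existence and law of the stochastic integral. -/

namespace IsStableWithScale

variable {Ω : Type*} [MeasurableSpace Ω] {P : Measure Ω} {X : ℝ → Ω → ℝ} {α C : ℝ}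
  {a b : ℝ} {f g : ℝ → ℝ}

/-- The difference of two Riemann–Stieltjes sums of small mesh is a stable variable of small
scale. -/
theorem exists_charFun_stieltjesSum_sub (hX : IsStableWithScale P α C X) (hα : 0 < α)
    (hab : a ≤ b) (hf : ContinuousOn f (Set.Icc a b)) {ε : ℝ} (hε : 0 < ε) :
    ∃ δ > 0, ∀ π π' : IntervalPartition a b, π.mesh < δ → π'.mesh < δ →
      ∃ s ∈ Set.Icc 0 ε, ∀ u : ℝ,
        charFun (P.map (fun ω => π.stieltjesSum X f ω - π'.stieltjesSum X f ω)) u =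
          ((Real.exp (-C * |u| ^ α * s) : ℝ) : ℂ) := by
  have hba := sub_nonneg.2 hab
  -- Chosen so that oscillation at most `r` contributes at most `r ^ α * (b - a) ≤ ε` to the scale.
  set r : ℝ := (ε / (b - a + 1)) ^ α⁻¹ with hr
  have hr0 : 0 < r := by positivity
  have hrα : r ^ α = ε / (b - a + 1) := Real.rpow_inv_rpow (by positivity) hα.ne'
  obtain ⟨δ, hδ, h⟩ := Metric.uniformContinuousOn_iff.1
    (isCompact_Icc.uniformContinuousOn_of_continuous hf) _ hr0
  -- The two tags attached to a refined cell each lie within `δ / 2` of its left endpoint.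
  refine ⟨δ / 2, half_pos hδ, fun π π' hπ hπ' => ?_⟩
  obtain ⟨N, t, ht, h0, hN, h1, h2⟩ := π.exists_common_points π'
  obtain ⟨σ, hσ, hS⟩ := π.exists_refine N t ht h0 hN h1
  obtain ⟨σ', hσ', hS'⟩ := π'.exists_refine N t ht h0 hN h2
  have hle : ∀ k : Fin N, 0 ≤ t k.succ - t k.castSucc := fun k =>
    sub_nonneg.2 (ht.monotone k.castSucc_lt_succ.le)
  refine ⟨∑ k, |f (σ k) - f (σ' k)| ^ α * (t k.succ - t k.castSucc), ⟨?_, ?_⟩, fun u => ?_⟩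
  · exact Finset.sum_nonneg fun k _ => mul_nonneg (by positivity) (hle k)
  · calc _ ≤ ∑ k : Fin N, ε / (b - a + 1) * (t k.succ - t k.castSucc) := by
          refine Finset.sum_le_sum fun k _ => mul_le_mul_of_nonneg_right ?_ (hle k)
          rw [← hrα]
          refine Real.rpow_le_rpow (abs_nonneg _) ?_ hα.le
          rw [← Real.dist_eq]
          refine (h _ (hσ k).1 _ (hσ' k).1 ?_).le
          have e1 := abs_le.1 (hσ k).2
          have e2 := abs_le.1 (hσ' k).2
          rw [Real.dist_eq, abs_lt]
          constructor <;> linarith [e1.1, e1.2, e2.1, e2.2]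
      _ = ε / (b - a + 1) * (b - a) := by
          rw [← Finset.mul_sum, IntervalPartition.sum_length, h0, hN]
      _ ≤ ε / (b - a + 1) * (b - a + 1) := by gcongr; linarith
      _ = ε := by field_simp
  · rw [← hX.charFun_map_sum_increments N t ht.monotone]
    congr 3
    ext ω
    rw [hS X f ω, hS' X f ω, ← Finset.sum_sub_distrib]
    exact Finset.sum_congr rfl fun k _ => by ring

/-- Tail bound for a stable variable. -/
theorem _root_.measureReal_lt_abs_le_of_charFun [IsProbabilityMeasure P] {Y : Ω → ℝ}
    (hY : Measurable Y) {s : ℝ} (hs : 0 ≤ s) (hC : 0 < C) (hα : 0 < α)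
    (h : ∀ u : ℝ, charFun (P.map Y) u = ((Real.exp (-C * |u| ^ α * s) : ℝ) : ℂ)) {r : ℝ}
    (hr : 0 < r) : P.real {ω | r < |Y ω|} ≤ 2 * C * (2 / r) ^ α * s := by
  have hprob : IsProbabilityMeasure (P.map Y) := Measure.isProbabilityMeasure_map hY.aemeasurable
  have h1 := measureReal_abs_gt_le_integral_charFun (μ := P.map Y) hr
  rw [map_measureReal_apply hY (measurableSet_lt measurable_const (by fun_prop))] at h1
  refine h1.trans ?_
  have h2 : ‖∫ u in (-2 * r⁻¹)..(2 * r⁻¹), 1 - charFun (P.map Y) u‖ ≤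
      C * (2 / r) ^ α * s * |2 * r⁻¹ - -2 * r⁻¹| := by
    refine intervalIntegral.norm_integral_le_of_norm_le_const fun u hu => ?_
    have hr' : 0 < r⁻¹ := inv_pos.2 hr
    rw [Set.uIoc_of_le (by linarith)] at hu
    have hu' : |u| ≤ 2 / r := by
      rw [div_eq_mul_inv, abs_le]; constructor <;> linarith [hu.1, hu.2]
    rw [h, ← Complex.ofReal_one, ← Complex.ofReal_sub, Complex.norm_real, Real.norm_eq_abs]
    have hpow : |u| ^ α ≤ (2 / r) ^ α := Real.rpow_le_rpow (abs_nonneg _) hu' hα.le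
    have hnn : 0 ≤ |u| ^ α := by positivity
    have e1 := Real.add_one_le_exp (-C * |u| ^ α * s)
    have e2 : Real.exp (-C * |u| ^ α * s) ≤ 1 := Real.exp_le_one_iff.2 (by
      have : 0 ≤ C * |u| ^ α * s := by positivity
      linarith)
    rw [abs_of_nonneg (by linarith)]
    have : C * |u| ^ α * s ≤ C * (2 / r) ^ α * s := by gcongr
    linarith
  calc _ ≤ 2⁻¹ * r * (C * (2 / r) ^ α * s * |2 * r⁻¹ - -2 * r⁻¹|) := by gcongr
    _ = _ := by
      rw [abs_of_nonneg (by have := inv_pos.2 hr; linarith)]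
      field_simp
      ring

/-- Existence of the stochastic integral of a continuous function. -/
theorem exists_isStochasticIntegral [IsProbabilityMeasure P] (hX : IsStableWithScale P α C X)
    (hC : 0 < C) (hα : 0 < α) (hab : a ≤ b) (hf : ContinuousOn f (Set.Icc a b)) :
    ∃ I, IsStochasticIntegral P X a b f I := by
  have : (comap (IntervalPartition.mesh (a := a) (b := b)) (𝓝 0)).NeBot :=
    (IntervalPartition.tendsto_uniform hab).neBot
  obtain ⟨I, hI, hlim⟩ := exists_tendstoInMeasure_of_cauchy (P := P)
    (l := comap (IntervalPartition.mesh (a := a) (b := b)) (𝓝 0))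
    (F := fun π => π.stieltjesSum X f) (fun π => π.measurable_stieltjesSum hX.measurable f)
    (fun ε hε => by
      -- This is the tail-bound constant at level `ε / 2`; halving passes from `ε ≤ |·|` to a strict
      -- inequality.
      have hK : 0 < 2 * C * (2 / (ε / 2)) ^ α := by positivity
      obtain ⟨δ, hδ, h⟩ := hX.exists_charFun_stieltjesSum_sub hα hab hf (div_pos hε hK)
      refine ⟨_, IntervalPartition.eventually_mesh_lt hδ, fun π hπ π' hπ' => ?_⟩
      obtain ⟨s, hs, hch⟩ := h π π' hπ hπ'
      have hb := measureReal_lt_abs_le_of_charFun ((π.measurable_stieltjesSum hX.measurable f).sub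
        (π'.measurable_stieltjesSum hX.measurable f)) hs.1 hC hα hch (half_pos hε)
      calc _ ≤ _ := measureReal_mono fun ω (hω : ε ≤ _) => (half_lt_self hε).trans_le hω
        _ ≤ _ := hb
        _ ≤ 2 * C * (2 / (ε / 2)) ^ α * (ε / (2 * C * (2 / (ε / 2)) ^ α)) := by
          gcongr; exact hs.2
        _ = ε := mul_div_cancel₀ _ hK.ne')
  exact ⟨I, hI, hlim⟩

/-- Characteristic function of the stochastic integral of a continuous function. -/
theorem charFun_map_stochasticIntegral [IsProbabilityMeasure P] (hX : IsStableWithScale P α C X)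
    (hα : 0 < α) (hab : a ≤ b) (hf : ContinuousOn f (Set.Icc a b)) {I : Ω → ℝ}
    (hI : IsStochasticIntegral P X a b f I) (u : ℝ) :
    charFun (P.map I) u = ((Real.exp (-C * |u| ^ α * ∫ x in a..b, |f x| ^ α) : ℝ) : ℂ) := by
  -- Convergence in probability gives convergence in law, hence of characteristic functions; their
  -- exponents are Riemann sums of `|f|^α`.
  have hdist := (hI.tendsto.comp (IntervalPartition.tendsto_uniform hab)).tendstoInDistribution
    (fun n => ((IntervalPartition.uniform hab n).measurable_stieltjesSum
      hX.measurable f).aemeasurable)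
  have h1 := ProbabilityMeasure.tendsto_iff_tendsto_charFun.1 hdist.tendsto u
  refine tendsto_nhds_unique h1 ?_
  have hg : ContinuousOn (fun x => |f x| ^ α) (Set.Icc a b) :=
    hf.abs.rpow_const fun _ _ => Or.inr hα.le
  have h2 := (IntervalPartition.tendsto_riemannSum hab hg).comp
    (IntervalPartition.tendsto_uniform hab)
  have h3 := (Complex.continuous_ofReal.tendsto _).comp
    ((Real.continuous_exp.tendsto _).comp (h2.const_mul (-C * |u| ^ α)))
  refine h3.congr fun n => ?_
  simp only [ProbabilityMeasure.coe_mk, Function.comp_apply]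
  rw [← hX.charFun_map_sum_increments _ _ (IntervalPartition.uniform hab n).mono]
  rfl

end IsStableWithScale

/-! ### Linearity and the consequence of independence. -/

namespace IsStochasticIntegral

variable {Ω : Type*} [MeasurableSpace Ω] {P : Measure Ω} [IsProbabilityMeasure P]
  {X : ℝ → Ω → ℝ} {a b : ℝ} {f g : ℝ → ℝ} {I J : Ω → ℝ}

theorem add (hI : IsStochasticIntegral P X a b f I) (hJ : IsStochasticIntegral P X a b g J) :
    IsStochasticIntegral P X a b (fun t => f t + g t) (fun ω => I ω + J ω) where
  measurable := hI.measurable.add hJ.measurable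
  tendsto := by
    convert TendstoInMeasure.add hI.tendsto hJ.tendsto using 3 with π ω
    simp only [IntervalPartition.stieltjesSum, ← Finset.sum_add_distrib, add_mul]

theorem neg (hI : IsStochasticIntegral P X a b f I) :
    IsStochasticIntegral P X a b (fun t => -f t) (fun ω => -I ω) where
  measurable := hI.measurable.neg
  tendsto := by
    convert TendstoInMeasure.neg hI.tendsto using 3 with π ω
    simp only [IntervalPartition.stieltjesSum, ← Finset.sum_neg_distrib, neg_mul]

/-- Independence of two stochastic integrals forces additivity of the scale parameters. -/
theorem integral_abs_add_rpow_of_indepFun {α C : ℝ} (hX : IsStableWithScale P α C X) (hC : 0 < C)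
    (hα : 0 < α) (hab : a ≤ b) (hf : ContinuousOn f (Set.Icc a b))
    (hg : ContinuousOn g (Set.Icc a b)) (hI : IsStochasticIntegral P X a b f I)
    (hJ : IsStochasticIntegral P X a b g J) (hIJ : IndepFun I J P) :
    ∫ x in a..b, |f x + g x| ^ α = (∫ x in a..b, |f x| ^ α) + ∫ x in a..b, |g x| ^ α := by
  have h1 := hX.charFun_map_stochasticIntegral hα hab (hf.add hg) (hI.add hJ) 1
  rw [hIJ.charFun_map_fun_add_eq_mul hI.measurable.aemeasurable hJ.measurable.aemeasurable,
    Pi.mul_apply, hX.charFun_map_stochasticIntegral hα hab hf hI,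
    hX.charFun_map_stochasticIntegral hα hab hg hJ, ← Complex.ofReal_mul, Complex.ofReal_inj,
    ← Real.exp_add, Real.exp_eq_exp, abs_one, Real.one_rpow, ← mul_add] at h1
  exact (mul_left_cancel₀ (by simpa using hC.ne') h1).symm

end IsStochasticIntegral

/-! ### Power inequalities below the Gaussian exponent. -/

/-- Strict subadditivity of powers with exponent below `1`. -/
theorem rpow_add_lt_add_rpow {p x y : ℝ} (hx : 0 < x) (hy : 0 < y) (hp : p < 1) :
    (x + y) ^ p < x ^ p + y ^ p := by
  -- Reduces the claim to strict decrease of `z ^ (p - 1)`.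
  have h : ∀ z : ℝ, 0 < z → z ^ p = z * z ^ (p - 1) := fun z hz => by
    rw [Real.rpow_sub_one hz.ne', mul_div_cancel₀ _ hz.ne']
  rw [h _ (add_pos hx hy), h x hx, h y hy, add_mul]
  have hp' : p - 1 < 0 := by linarith
  have h1 : (x + y) ^ (p - 1) < x ^ (p - 1) := Real.rpow_lt_rpow_of_neg hx (by linarith) hp'
  have h2 : (x + y) ^ (p - 1) < y ^ (p - 1) := Real.rpow_lt_rpow_of_neg hy (by linarith) hp'
  gcongr

/-- Strict form of the parallelogram inequality for exponents below `2`. -/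
theorem abs_add_rpow_add_abs_sub_rpow_lt {α x y : ℝ} (hα : 0 < α) (hα2 : α < 2) (hx : x ≠ 0)
    (hy : y ≠ 0) : |x + y| ^ α + |x - y| ^ α < 2 * (|x| ^ α + |y| ^ α) := by
  -- The squares `(x ± y)^2` average to `x^2 + y^2`; concavity of the power `α / 2` handles the
  -- average, and strict subadditivity splits the sum.
  have hsq : ∀ z : ℝ, |z| ^ α = (z ^ 2) ^ (α / 2) := fun z => by
    rw [← sq_abs, ← Real.rpow_natCast, ← Real.rpow_mul (abs_nonneg z)]
    congr 1
    push_cast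
    ring
  have hp0 : 0 < α / 2 := by linarith
  have hp1 : α / 2 < 1 := by linarith
  have hx2 : 0 < x ^ 2 := by positivity
  have hy2 : 0 < y ^ 2 := by positivity
  have h1 : (x ^ 2 + y ^ 2) ^ (α / 2) < (x ^ 2) ^ (α / 2) + (y ^ 2) ^ (α / 2) :=
    rpow_add_lt_add_rpow hx2 hy2 hp1
  obtain ⟨-, hconc⟩ := Real.concaveOn_rpow hp0.le hp1.le
  have h2 := hconc (Set.mem_Ici.2 (sq_nonneg (x + y))) (Set.mem_Ici.2 (sq_nonneg (x - y)))
    (by norm_num : (0 : ℝ) ≤ 1 / 2) (by norm_num : (0 : ℝ) ≤ 1 / 2) (by norm_num)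
  simp only [smul_eq_mul] at h2
  rw [show 1 / 2 * (x + y) ^ 2 + 1 / 2 * (x - y) ^ 2 = x ^ 2 + y ^ 2 by ring] at h2
  simp only [hsq]
  linarith

theorem abs_add_rpow_add_abs_sub_rpow_le {α : ℝ} (hα : 0 < α) (hα2 : α < 2) (x y : ℝ) :
    |x + y| ^ α + |x - y| ^ α ≤ 2 * (|x| ^ α + |y| ^ α) := by
  rcases eq_or_ne x 0 with rfl | hx
  · simp [Real.zero_rpow hα.ne', two_mul]
  rcases eq_or_ne y 0 with rfl | hy
  · simp [Real.zero_rpow hα.ne', two_mul]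
  exact (abs_add_rpow_add_abs_sub_rpow_lt hα hα2 hx hy).le

/-! ### Jacobi weights, inner products and polynomials. -/

theorem jacobiWeight_pos (a b : ℝ) {t : ℝ} (ht : t ∈ Set.Ioo (-1 : ℝ) 1) :
    0 < jacobiWeight a b t :=
  mul_pos (Real.rpow_pos_of_pos (by linarith [ht.2]) _)
    (Real.rpow_pos_of_pos (by linarith [ht.1]) _)

theorem continuous_jacobiWeight {a b : ℝ} (ha : 0 ≤ a) (hb : 0 ≤ b) :
    Continuous (jacobiWeight a b) :=
  ((continuous_const.sub continuous_id).rpow_const fun _ => Or.inr ha).mul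
    ((continuous_const.add continuous_id).rpow_const fun _ => Or.inr hb)

/-- Splitting at `0` isolates the endpoint singularities: on each half one factor is an integrable
power and the other is continuous. -/
theorem intervalIntegrable_jacobiWeight {a b : ℝ} (ha : -1 < a) (hb : -1 < b) :
    IntervalIntegrable (jacobiWeight a b) volume (-1) 1 := by
  have hR : IntervalIntegrable (fun t : ℝ => (1 - t) ^ a) volume 0 1 := by
    simpa using ((intervalIntegral.intervalIntegrable_rpow' ha (a := 0) (b := 1)).comp_sub_left
      1).symm
  have hL : IntervalIntegrable (fun t : ℝ => (1 + t) ^ b) volume (-1) 0 := by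
    simpa using (intervalIntegral.intervalIntegrable_rpow' hb (a := 0) (b := 1)).comp_add_left 1
  refine IntervalIntegrable.trans (b := 0) ?_ ?_
  · refine hL.continuousOn_mul (ContinuousOn.rpow_const (by fun_prop) fun t ht => Or.inl ?_)
    rw [Set.uIcc_of_le (by norm_num)] at ht
    linarith [ht.2]
  · refine hR.mul_continuousOn (ContinuousOn.rpow_const (by fun_prop) fun t ht => Or.inl ?_)
    rw [Set.uIcc_of_le (by norm_num)] at ht
    linarith [ht.1]

section JacobiInner

variable {a b : ℝ} (ha : -1 < a) (hb : -1 < b)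

include ha hb in
theorem intervalIntegrable_mul_jacobiWeight (p q : ℝ[X]) :
    IntervalIntegrable (fun t => p.eval t * q.eval t * jacobiWeight a b t) volume (-1) 1 :=
  (intervalIntegrable_jacobiWeight ha hb).continuousOn_mul
    (p.continuous.mul q.continuous).continuousOn

theorem jacobiInner_comm (p q : ℝ[X]) : jacobiInner a b p q = jacobiInner a b q p := by
  simp only [jacobiInner, mul_comm (p.eval _)]

theorem jacobiInner_C_mul_left (c : ℝ) (p q : ℝ[X]) :
    jacobiInner a b (C c * p) q = c * jacobiInner a b p q := by
  simp only [jacobiInner, ← intervalIntegral.integral_const_mul, eval_mul, eval_C, mul_assoc]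

include ha hb in
theorem jacobiInner_add_left (p q r : ℝ[X]) :
    jacobiInner a b (p + q) r = jacobiInner a b p r + jacobiInner a b q r := by
  simp only [jacobiInner]
  rw [← intervalIntegral.integral_add (intervalIntegrable_mul_jacobiWeight ha hb p r)
    (intervalIntegrable_mul_jacobiWeight ha hb q r)]
  simp only [eval_add, add_mul]

include ha hb in
theorem jacobiInner_sub_left (p q r : ℝ[X]) :
    jacobiInner a b (p - q) r = jacobiInner a b p r - jacobiInner a b q r := by
  simp only [jacobiInner]
  rw [← intervalIntegral.integral_sub (intervalIntegrable_mul_jacobiWeight ha hb p r)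
    (intervalIntegrable_mul_jacobiWeight ha hb q r)]
  simp only [eval_sub, sub_mul]

include ha hb in
theorem jacobiInner_self_pos {p : ℝ[X]} (hp : p ≠ 0) : 0 < jacobiInner a b p p := by
  -- The integrand is nonzero on the open interval minus the finite root set, which has full measure
  -- there.
  have hnull : volume (p.rootSet ℝ) = 0 := (p.rootSet_finite ℝ).measure_zero _
  have hsub : Set.Ioo (-1 : ℝ) 1 \ p.rootSet ℝ ⊆
      Function.support (fun t => p.eval t * p.eval t * jacobiWeight a b t) ∩ Set.Ioc (-1) 1 := by
    intro t ht
    have : p.eval t ≠ 0 := fun h => ht.2 (by simp [mem_rootSet, hp, h])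
    exact ⟨mul_ne_zero (mul_ne_zero this this) (jacobiWeight_pos a b ht.1).ne',
      ht.1.1, ht.1.2.le⟩
  refine (intervalIntegral.integral_pos_iff_support_of_nonneg_ae' ?_
    (intervalIntegrable_mul_jacobiWeight ha hb p p)).2 ⟨by norm_num, ?_⟩
  · rw [Set.uIoc_of_le (by norm_num)]
    refine (ae_restrict_iff' measurableSet_Ioc).2 (.of_forall fun t ht => ?_)
    exact mul_nonneg (mul_self_nonneg _) (mul_nonneg
      (Real.rpow_nonneg (by linarith [ht.2]) _) (Real.rpow_nonneg (by linarith [ht.1]) _))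
  · refine lt_of_lt_of_le ?_ (measure_mono hsub)
    rw [measure_sdiff_null hnull]
    simp

end JacobiInner

theorem monic_jacobiMonic (γ δ : ℝ) (n : ℕ) :
    (jacobiMonic γ δ n).Monic ∧ (jacobiMonic γ δ n).natDegree = n := by
  induction n using Nat.strong_induction_on with
  | _ n ih =>
    have hdeg : (∑ k : Fin n, C (jacobiInner γ δ (X ^ n) (jacobiMonic γ δ k) /
        jacobiInner γ δ (jacobiMonic γ δ k) (jacobiMonic γ δ k)) * jacobiMonic γ δ k).degree <
        (n : WithBot ℕ) := by
      refine mem_degreeLT.1 (Submodule.sum_mem _ fun k _ => ?_)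
      rw [← smul_eq_C_mul]
      refine Submodule.smul_mem _ _ (mem_degreeLT.2 ?_)
      rw [degree_eq_natDegree (ih k k.2).1.ne_zero, (ih k k.2).2]
      exact_mod_cast k.2
    rw [jacobiMonic]
    refine ⟨monic_X_pow_sub hdeg, ?_⟩
    refine natDegree_eq_of_degree_eq_some ?_
    rw [degree_sub_eq_left_of_degree_lt (by rwa [degree_X_pow]), degree_X_pow]

theorem jacobiPoly_ne_zero {γ δ : ℝ} (hγ : -1 < γ) (hδ : -1 < δ) (n : ℕ) :
    jacobiPoly γ δ n ≠ 0 := by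
  have h0 := (monic_jacobiMonic γ δ n).1.ne_zero
  have := jacobiInner_self_pos hγ hδ h0
  exact mul_ne_zero (C_ne_zero.2 (by positivity)) h0

/-! ### Moments determine the Jacobi exponents. -/

/-- Integration by parts against the Jacobi weight (Pearson's equation). -/
theorem jacobiInner_pearson {a b : ℝ} (ha : -1 < a) (hb : -1 < b) (q : ℝ[X]) :
    jacobiInner a b (derivative q * (1 - X ^ 2) + (C (b - a) - C (a + b + 2) * X) * q) 1 = 0 := by
  -- The primitive has exponents `a + 1, b + 1 > 0`, so it is continuous up to the endpoints and
  -- vanishes there.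
  have hcont : ContinuousOn (fun t : ℝ => q.eval t * ((1 - t) ^ (a + 1) * (1 + t) ^ (b + 1)))
      (Set.Icc (-1) 1) :=
    (q.continuous.mul (continuous_jacobiWeight (by linarith : 0 ≤ a + 1)
      (by linarith : 0 ≤ b + 1))).continuousOn
  have hder : ∀ t ∈ Set.Ioo (-1 : ℝ) 1,
      HasDerivAt (fun t : ℝ => q.eval t * ((1 - t) ^ (a + 1) * (1 + t) ^ (b + 1)))
        ((derivative q * (1 - X ^ 2) + (C (b - a) - C (a + b + 2) * X) * q).eval t *
          (1 : ℝ[X]).eval t * jacobiWeight a b t) t := by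
    intro t ht
    have h1 : 0 < 1 - t := by linarith [ht.2]
    have h2 : 0 < 1 + t := by linarith [ht.1]
    have d1 := ((hasDerivAt_id t).const_sub 1).rpow_const (p := a + 1) (Or.inl h1.ne')
    have d2 := ((hasDerivAt_id t).const_add 1).rpow_const (p := b + 1) (Or.inl h2.ne')
    refine ((q.hasDerivAt t).mul (d1.mul d2)).congr_deriv ?_
    simp only [id, add_sub_cancel_right, Real.rpow_add h1, Real.rpow_add h2, Real.rpow_one,
      jacobiWeight, eval_add, eval_mul, eval_sub, eval_one, eval_pow, eval_X, eval_C, Pi.mul_apply]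
    ring
  have := intervalIntegral.integral_eq_sub_of_hasDerivAt_of_le (by norm_num) hcont hder
    (intervalIntegrable_mul_jacobiWeight ha hb _ 1)
  rw [jacobiInner, this]
  simp [Real.zero_rpow (by linarith : a + 1 ≠ 0), Real.zero_rpow (by linarith : b + 1 ≠ 0)]

/-- Pearson's equation with `q = 1`. -/
theorem jacobiInner_X_one {a b : ℝ} (ha : -1 < a) (hb : -1 < b) :
    (a + b + 2) * jacobiInner a b X 1 = (b - a) * jacobiInner a b 1 1 := by
  have h := jacobiInner_pearson ha hb 1
  rw [show derivative (1 : ℝ[X]) * (1 - X ^ 2) + (C (b - a) - C (a + b + 2) * X) * 1 =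
    C (b - a) * 1 - C (a + b + 2) * X by simp, jacobiInner_sub_left ha hb,
    jacobiInner_C_mul_left, jacobiInner_C_mul_left] at h
  linarith

/-- Pearson's equation with `q = X`. -/
theorem jacobiInner_X_sq_one {a b : ℝ} (ha : -1 < a) (hb : -1 < b) :
    (a + b + 3) * jacobiInner a b (X ^ 2) 1 =
      jacobiInner a b 1 1 + (b - a) * jacobiInner a b X 1 := by
  have h := jacobiInner_pearson ha hb X
  rw [show derivative (X : ℝ[X]) * (1 - X ^ 2) + (C (b - a) - C (a + b + 2) * X) * X =
    1 + C (b - a) * X - C (a + b + 3) * X ^ 2 by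
      rw [show a + b + 3 = a + b + 2 + 1 by ring, C_add (b := (1 : ℝ)), derivative_X, C_1]; ring,
    jacobiInner_sub_left ha hb, jacobiInner_add_left ha hb,
    jacobiInner_C_mul_left, jacobiInner_C_mul_left] at h
  linarith

/-- If the Jacobi polynomials of degrees `1` and `2` are orthogonal to the constants with respect
to another Jacobi weight, then the two weights have the same exponents. -/
theorem jacobi_exponents_eq {a b a' b' : ℝ} (ha : -1 < a) (hb : -1 < b) (ha' : -1 < a')
    (hb' : -1 < b') (h1 : jacobiInner a' b' (jacobiMonic a b 1) 1 = 0)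
    (h2 : jacobiInner a' b' (jacobiMonic a b 2) 1 = 0) : a = a' ∧ b = b' := by
  have e0 : jacobiMonic a b 0 = 1 := by rw [jacobiMonic]; simp
  have hL := jacobiInner_self_pos ha hb (one_ne_zero (α := ℝ[X]))
  have hL' := jacobiInner_self_pos ha' hb' (one_ne_zero (α := ℝ[X]))
  have m2 : jacobiInner a' b' (X ^ 2) 1 =
      jacobiInner a b (X ^ 2) 1 / jacobiInner a b 1 1 * jacobiInner a' b' 1 1 := by
    rw [jacobiMonic, Fin.sum_univ_two, jacobiInner_sub_left ha' hb', jacobiInner_add_left ha' hb',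
      jacobiInner_C_mul_left, jacobiInner_C_mul_left] at h2
    simp only [Fin.val_zero, Fin.val_one, e0, h1] at h2
    linarith
  have m1 : jacobiInner a' b' X 1 =
      jacobiInner a b X 1 / jacobiInner a b 1 1 * jacobiInner a' b' 1 1 := by
    rw [jacobiMonic, Fin.sum_univ_one, jacobiInner_sub_left ha' hb',
      jacobiInner_C_mul_left] at h1
    simp only [Fin.val_zero, e0, pow_one] at h1
    linarith
  have r1 := jacobiInner_X_one ha hb
  have r2 := jacobiInner_X_sq_one ha hb
  have r1' := jacobiInner_X_one ha' hb'
  have r2' := jacobiInner_X_sq_one ha' hb'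
  -- `u` and `v` are the normalised first and second moments, shared by both weights.
  set u := jacobiInner a b X 1 / jacobiInner a b 1 1 with hu
  set v := jacobiInner a b (X ^ 2) 1 / jacobiInner a b 1 1 with hv
  rw [m1] at r1' r2'
  rw [m2] at r2'
  rw [show jacobiInner a b X 1 = u * jacobiInner a b 1 1 by rw [hu]; field_simp] at r1 r2
  rw [show jacobiInner a b (X ^ 2) 1 = v * jacobiInner a b 1 1 by rw [hv]; field_simp] at r2
  have s1 : (a + b + 2) * u = b - a := mul_right_cancel₀ hL.ne' (by linarith)
  have s1' : (a' + b' + 2) * u = b' - a' := mul_right_cancel₀ hL'.ne' (by linarith)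
  have s2 : (a + b + 3) * v = 1 + (b - a) * u := mul_right_cancel₀ hL.ne' (by linarith)
  have s2' : (a' + b' + 3) * v = 1 + (b' - a') * u := mul_right_cancel₀ hL'.ne' (by linarith)
  -- The variance is nonzero: otherwise the moment relations give `u = ±1`, forcing `a = -1` or `b =
  -- -1`.
  have hne : v - u ^ 2 ≠ 0 := by
    intro h
    have h3 : (1 - u) * (1 + u) = 0 := by
      rw [← s1] at s2
      have : v = u ^ 2 := by linarith
      rw [this] at s2
      linarith
    rcases mul_eq_zero.1 h3 with h | h
    · have : u = 1 := by linarith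
      rw [this] at s1; linarith
    · have : u = -1 := by linarith
      rw [this] at s1; linarith
  -- With `S = a + b`, both weights satisfy `(S + 3) v = 1 + (S + 2) u^2`; subtract the two
  -- instances.
  have hS : (a + b - (a' + b')) * (v - u ^ 2) = 0 := by
    rw [← s1] at s2
    rw [← s1'] at s2'
    linarith
  have hS' : a + b = a' + b' := by
    have := (mul_eq_zero.1 hS).resolve_right hne
    linarith
  rw [hS'] at s1
  constructor <;> linarith

/-- Source of the special exponents: a product of two integrands carries the squared weight.
Nonnegative exponents make this valid at the endpoints too. -/
theorem jacobiWeight_mul_self {η τ t : ℝ} (hη : 0 ≤ η) (hτ : 0 ≤ τ)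
    (ht : t ∈ Set.Icc (-1 : ℝ) 1) :
    jacobiWeight η τ t * jacobiWeight η τ t = jacobiWeight (2 * η) (2 * τ) t := by
  simp only [jacobiWeight, two_mul]
  rw [Real.rpow_add_of_nonneg (by linarith [ht.2]) hη hη,
    Real.rpow_add_of_nonneg (by linarith [ht.1]) hτ hτ]
  ring

/-! ### Dependence below index two, orthogonality at index two. -/

section StableCoefficients

variable {Ω : Type*} [MeasurableSpace Ω] {P : Measure Ω} [IsProbabilityMeasure P]
  {X : ℝ → Ω → ℝ} {α C : ℝ} {a b : ℝ} {f g : ℝ → ℝ} {I J : Ω → ℝ}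

/-- Below the Gaussian index, stochastic integrals of continuous functions whose product is not
identically zero are dependent. -/
theorem IsStochasticIntegral.not_indepFun (hX : IsStableWithScale P α C X) (hC : 0 < C)
    (hα : 0 < α) (hα2 : α < 2) (hab : a < b) (hf : ContinuousOn f (Set.Icc a b))
    (hg : ContinuousOn g (Set.Icc a b)) (hI : IsStochasticIntegral P X a b f I)
    (hJ : IsStochasticIntegral P X a b g J) (hfg : ∃ t ∈ Set.Icc a b, f t ≠ 0 ∧ g t ≠ 0) :
    ¬ IndepFun I J P := by
  intro hind
  have h1 := hI.integral_abs_add_rpow_of_indepFun hX hC hα hab.le hf hg hJ hind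
  -- Independence survives `J ↦ -J`, giving the companion identity for `f - g`.
  have h2 := hI.integral_abs_add_rpow_of_indepFun hX hC hα hab.le hf hg.neg hJ.neg
    (hind.comp measurable_id measurable_neg)
  simp only [← sub_eq_add_neg, Pi.neg_apply, abs_neg] at h2
  have hpow : ∀ {h : ℝ → ℝ}, ContinuousOn h (Set.Icc a b) →
      ContinuousOn (fun t => |h t| ^ α) (Set.Icc a b) := fun hh =>
    hh.abs.rpow_const fun _ _ => Or.inr hα.le
  have hint : ∀ {h : ℝ → ℝ}, ContinuousOn h (Set.Icc a b) →
      IntervalIntegrable (fun t => |h t| ^ α) volume a b := fun hh =>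
    (hpow hh).intervalIntegrable_of_Icc hab.le
  obtain ⟨t, ht, hft, hgt⟩ := hfg
  -- By continuity, strictness at the single point `t` makes the integral inequality strict.
  have hlt : ∫ t in a..b, (|f t + g t| ^ α + |f t - g t| ^ α) <
      ∫ t in a..b, 2 * (|f t| ^ α + |g t| ^ α) := intervalIntegral.integral_lt_integral_of_continuousOn_of_le_of_exists_lt hab
    ((hpow (hf.add hg)).add (hpow (hf.sub hg)))
    (continuousOn_const.mul ((hpow hf).add (hpow hg)))
    (fun t _ => abs_add_rpow_add_abs_sub_rpow_le hα hα2 (f t) (g t))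
    ⟨t, ht, abs_add_rpow_add_abs_sub_rpow_lt hα hα2 hft hgt⟩
  have i1 : IntervalIntegrable (fun t => |f t + g t| ^ α) volume a b := hint (hf.add hg)
  have i2 : IntervalIntegrable (fun t => |f t - g t| ^ α) volume a b := hint (hf.sub hg)
  rw [intervalIntegral.integral_add i1 i2,
    intervalIntegral.integral_const_mul, intervalIntegral.integral_add (hint hf) (hint hg)] at hlt
  linarith

/-- In the Gaussian case, independence of stochastic integrals implies orthogonality. -/
theorem IsStochasticIntegral.integral_mul_eq_zero (hX : IsStableWithScale P 2 C X) (hC : 0 < C)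
    (hab : a ≤ b) (hf : ContinuousOn f (Set.Icc a b))
    (hg : ContinuousOn g (Set.Icc a b)) (hI : IsStochasticIntegral P X a b f I)
    (hJ : IsStochasticIntegral P X a b g J) (hind : IndepFun I J P) :
    ∫ t in a..b, f t * g t = 0 := by
  have h := hI.integral_abs_add_rpow_of_indepFun hX hC two_pos hab hf hg hJ hind
  simp only [Real.rpow_two, sq_abs] at h
  have hint : ∀ {h : ℝ → ℝ}, ContinuousOn h (Set.Icc a b) → IntervalIntegrable h volume a b :=
    fun hh => hh.intervalIntegrable_of_Icc hab
  have e : ∫ t in a..b, (f t + g t) ^ 2 =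
      ∫ t in a..b, (f t ^ 2 + g t ^ 2) + 2 * (f t * g t) := by
    congr 1; ext t; ring
  have i1 : IntervalIntegrable (fun t => f t ^ 2) volume a b := hint (hf.pow 2)
  have i2 : IntervalIntegrable (fun t => g t ^ 2) volume a b := hint (hg.pow 2)
  have i3 : IntervalIntegrable (fun t => 2 * (f t * g t)) volume a b :=
    (hint (hf.mul hg)).const_mul 2
  rw [e, intervalIntegral.integral_add (i1.add i2) i3, intervalIntegral.integral_add i1 i2,
    intervalIntegral.integral_const_mul] at h
  linarith

end StableCoefficients

theorem theorem2p0 {Ω : Type*} [MeasurableSpace Ω] (P : Measure Ω) [IsProbabilityMeasure P]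
    (X : ℝ → Ω → ℝ) (α γ δ η τ : ℝ) (hα : α ∈ Set.Icc (1 : ℝ) 2)
    (hX : IsSymmetricStable P α X) (hγ : -1 < γ) (hδ : -1 < δ) (hη : 0 ≤ η) (hτ : 0 ≤ τ) :
    (∃ A : ℕ → Ω → ℝ, IsFourierJacobiCoeff P X γ δ η τ A) ∧
    ∀ A : ℕ → Ω → ℝ, IsFourierJacobiCoeff P X γ δ η τ A →
      (¬ (α = 2 ∧ γ = 2 * η ∧ δ = 2 * τ) → ¬ iIndepFun A P) ∧
      (α < 2 → ∀ n m : ℕ, n ≠ m → ¬ IndepFun (A n) (A m) P) := by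
  obtain ⟨c, hc, hX⟩ := hX.exists_scale
  have hα0 : 0 < α := by linarith [hα.1]
  have hcont : ∀ n, ContinuousOn (fun t => (jacobiPoly γ δ n).eval t * jacobiWeight η τ t)
      (Set.Icc (-1) 1) := fun n =>
    ((jacobiPoly γ δ n).continuous.mul (continuous_jacobiWeight hη hτ)).continuousOn
  refine ⟨?_, fun A hA => ?_⟩
  · choose A hA using fun n =>
      hX.exists_isStochasticIntegral hc hα0 (by norm_num : (-1 : ℝ) ≤ 1) (hcont n)
    exact ⟨A, hA⟩
  have hpair : α < 2 → ∀ n m : ℕ, n ≠ m → ¬ IndepFun (A n) (A m) P := by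
    intro hα2 n m _
    refine (hA n).not_indepFun hX hc hα0 hα2 (by norm_num) (hcont n) (hcont m) (hA m) ?_
    have hp : jacobiPoly γ δ n * jacobiPoly γ δ m ≠ 0 :=
      mul_ne_zero (jacobiPoly_ne_zero hγ hδ n) (jacobiPoly_ne_zero hγ hδ m)
    -- An interior point avoiding the finitely many roots of the product; the weight is positive
    -- there.
    obtain ⟨t, ht, hroot⟩ := (Set.Ioo_infinite (by norm_num : (-1 : ℝ) < 1)).exists_notMem_finset
      (jacobiPoly γ δ n * jacobiPoly γ δ m).roots.toFinset
    rw [Multiset.mem_toFinset, mem_roots hp, IsRoot, eval_mul, mul_eq_zero, not_or] at hroot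
    have hw := (jacobiWeight_pos η τ ht).ne'
    exact ⟨t, ⟨ht.1.le, ht.2.le⟩, mul_ne_zero hroot.1 hw, mul_ne_zero hroot.2 hw⟩
  refine ⟨fun hne hind => ?_, hpair⟩
  rcases hα.2.lt_or_eq with hα2 | rfl
  · exact hpair hα2 0 1 (by norm_num) (hind.indepFun (by norm_num))
  have e0 : jacobiMonic γ δ 0 = 1 := by rw [jacobiMonic]; simp
  -- Only independence from `A 0` is needed; the nonzero normalising constants cancel.
  have horth : ∀ n, n ≠ 0 → jacobiInner (2 * η) (2 * τ) (jacobiMonic γ δ n) 1 = 0 := by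
    intro n hn
    have h := (hA n).integral_mul_eq_zero hX hc (by norm_num) (hcont n) (hcont 0) (hA 0)
      (hind.indepFun hn)
    have h' : jacobiInner (2 * η) (2 * τ) (jacobiPoly γ δ n) (jacobiPoly γ δ 0) = 0 := by
      rw [← h, jacobiInner]
      refine intervalIntegral.integral_congr fun t ht => ?_
      rw [Set.uIcc_of_le (by norm_num)] at ht
      rw [← jacobiWeight_mul_self hη hτ ht]
      ring
    have hpos : ∀ k, 1 / √(jacobiInner γ δ (jacobiMonic γ δ k) (jacobiMonic γ δ k)) ≠ 0 :=
      fun k => by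
        have := jacobiInner_self_pos hγ hδ (monic_jacobiMonic γ δ k).1.ne_zero
        positivity
    rw [jacobiPoly, jacobiPoly, jacobiInner_C_mul_left,
      jacobiInner_comm (jacobiMonic γ δ n) (C _ * _), jacobiInner_C_mul_left,
      jacobiInner_comm (jacobiMonic γ δ 0) (jacobiMonic γ δ n), e0] at h'
    have h1 := (mul_eq_zero.1 h').resolve_left (hpos n)
    exact (mul_eq_zero.1 h1).resolve_left (e0 ▸ hpos 0)
  obtain ⟨h1, h2⟩ := jacobi_exponents_eq hγ hδ (by linarith : -1 < 2 * η)
    (by linarith : -1 < 2 * τ) (horth 1 one_ne_zero) (horth 2 two_ne_zero)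
  exact hne ⟨rfl, h1, h2⟩
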